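/- **Setting.** Let $\mathcal S$ (states) and $\mathcal A\neq\emptyset$ (actions) be measurable spaces and $H,K,d$ natural numbers. An episodic adversarial MDP $\mathcal M$ consists of an initial state distribution, Markov transition kernels $P_h(\cdot\mid s,a)$, $h\in[H]$, shared by all episodes, and loss functions $\ell_{k,h}:\mathcal S\times\mathcal A\to\mathbb R$, $k\in[K]$, $h\in[H]$. A policy is a family $\pi=(\pi_h)_{h\in[H]}$ of Markov kernels from states to actions; its value in episode $k$ is $V_k^\pi=\mathbb E_\pi\big[\sum_{h=1}^H\ell_{k,h}(s_h,a_h)\big]$. For a measurable feature map $\phi:\mathcal S\times\mathcal A\to\mathbb R^d$, the MDP is *linear with feature map $\phi$* if $\|\phi(s,a)\|_2\le 1$ for all $(s,a)$, and there are $\mathbb R^d$-valued measures $\mu_h$ on $\mathcal S$ with $P_h(\cdot\mid s,a)=\langle\phi(s,a),\mu_h(\cdot)\rangle$ and $\|\mu_h(\mathcal S)\|_2\le\sqrt d$, and vectors $\theta_{k,h}\in\mathbb R^d$ with $\ell_{k,h}(s,a)=\langle\phi(s,a),\theta_{k,h}\rangle$ and $\|\theta_{k,h}\|_2\le\sqrt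 d$. Assume that there is a countable set $\mathcal A_0\subseteq\mathcal A$ such that $\{\phi(s,a):a\in\mathcal A_0\}$ is dense in $\{\phi(s,a):a\in\mathcal A\}$ for every $s$ (this is automatic if $\mathcal A$ is finite or countable, and holds if $\mathcal A$ is separable and $\phi(s,\cdot)$ is continuous for every $s$). Given $\eta>0$ and finite nonempty sets $\mathcal A_s\subseteq\mathcal A$, $s\in\mathcal S$, the *linear softmax policy* with parameter $w=(w_h)_{h\in[H]}\in(\mathbb R^{d})^H$ is $$\pi_h(a\mid s)=\frac{\exp(\eta\langle\phi(s,a),w_h\rangle)}{\sum_{a'\in\mathcal A_s}\exp(\eta\langle\phi(s,a'),w_h\rangle)}\quad(a\in\mathcal A_s),\qquad \pi_h(\mathcal A\setminus\mathcal A_s\mid s)=0.$$ **Statement.** For every such $\phi$ (and $d,H,K$) there are $\eta>0$, finite nonempty action sets $\mathcal A_s$ (with $\mathcal A_s=\mathcal A$ for all $s$ if $\mathcal A$ is finite), and a finite nonempty set $\Pi$ of linear softmax policies for $\eta$ and $(\mathcal A_s)_s$ with $$|\Pi|\le\Big(1+32K^2H^4d^{5/2}\log(1+16HdK)\Big)^{dH^2},$$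 such that for every adversarial MDP that is linear with feature map $\phi$ (so $\Pi$ depends on neither the transitions nor the losses nor the initial distribution): 1. there is $\pi\in\Pi$ with $\sum_{k=1}^K\big(V_k^\pi-V_k^{\pi^*}\big)\le 1$ for every policy $\pi^*$, in particular for every $\pi^*$ minimizing $\sum_{k}V_k^{\pi^*}$ over all policies; 2. for all policies $\pi_1,\dots,\pi_K$ and every policy $\pi^*$ (in particular for every minimizer of $\sum_kV_k^{\pi^*}$), with $\mathrm{Reg}(K)=\sum_{k=1}^K(V_k^{\pi_k}-V_k^{\pi^*})$ and $\mathrm{Reg}(K;\Pi)=\sum_{k=1}^KV_k^{\pi_k}-\min_{\pi\in\Pi}\sum_{k=1}^KV_k^\pi$, $$\mathrm{Reg}(K)=\Big(\min_{\pi\in\Pi}\sum_{k=1}^KV_k^\pi-\sum_{k=1}^KV_k^{\pi^*}\Big)+\mathrm{Reg}(K;\Pi)\le\mathrm{Reg}(K;\Pi)+1.$$ -/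

import Mathlib

open MeasureTheory ProbabilityTheory

open scoped RealInnerProductSpace

noncomputable section

/-- An episodic MDP with horizon `H` and `K` episodes: a distribution of the initial state (a
Dirac measure if the initial state is fixed), a transition kernel for every step, shared by
all episodes, and one loss function for every episode and step. -/
structure AdversarialMDP (S A : Type*) [MeasurableSpace S] [MeasurableSpace A] (H K : ℕ) where
  init : Measure S
  init_prob : IsProbabilityMeasure init
  trans : Fin H → Kernel (S × A) S
  trans_markov : ∀ h, IsMarkovKernel (trans h)
  loss : Fin K → Fin H → S × A → ℝ

/-- A policy: for every step, a (measurable) map from states to distributions over actions. -/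
structure Policy (S A : Type*) [MeasurableSpace S] [MeasurableSpace A] (H : ℕ) where
  kernel : Fin H → Kernel S A
  markov : ∀ h, IsMarkovKernel (kernel h)

/-- The regularity of the action space that makes suprema over actions measurable: one countable
set of actions realizes, in every state, a dense subset of the features of that state. It holds
for every `φ` if the actions are countable (in particular finite) or the states are countable, and
it holds if the action space is separable and `φ (s, ·)` is continuous for every `s`. -/
def SeparableFeatures {S A : Type*} {d : ℕ} (φ : S × A → EuclideanSpace ℝ (Fin d)) : Prop :=
  ∃ A₀ : Set A, A₀.Countable ∧ ∀ s a, φ (s, a) ∈ closure ((fun b => φ (s, b)) '' A₀)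

/-- `π` is a linear softmax policy with inverse temperature `η` on the finite action sets `act s`:
for some parameter `w`, in state `s` at step `h` the action `a ∈ act s` has probability
`exp (η ⟪φ (s, a), w h⟫) / ∑ b ∈ act s, exp (η ⟪φ (s, b), w h⟫)`. -/
def IsLinearSoftmax {S A : Type*} [MeasurableSpace S] [MeasurableSpace A] {H d : ℕ}
    (φ : S × A → EuclideanSpace ℝ (Fin d)) (η : ℝ) (act : S → Finset A)
    (π : Policy S A H) : Prop :=
  ∃ w : Fin H → EuclideanSpace ℝ (Fin d), ∀ h s,
    π.kernel h s = ∑ a ∈ act s,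
      ENNReal.ofReal
        (Real.exp (η * ⟪φ (s, a), w h⟫) / ∑ b ∈ act s, Real.exp (η * ⟪φ (s, b), w h⟫)) •
        Measure.dirac a

namespace AdversarialMDP

variable {S A : Type*} [MeasurableSpace S] [MeasurableSpace A] {H K : ℕ}

/-- The MDP is linear for the feature map `φ`: transitions and losses are linear in the features,
with the usual normalization. -/
def IsLinear (M : AdversarialMDP S A H K) {d : ℕ} (φ : S × A → EuclideanSpace ℝ (Fin d)) :
    Prop :=
  (∀ x, ‖φ x‖ ≤ 1) ∧
  (∃ μ : Fin H → VectorMeasure S (EuclideanSpace ℝ (Fin d)), ∀ h,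
    ‖μ h Set.univ‖ ≤ √d ∧
      ∀ x B, MeasurableSet B → (M.trans h x).real B = ⟪φ x, μ h B⟫) ∧
  (∃ θ : Fin K → Fin H → EuclideanSpace ℝ (Fin d), ∀ k h,
    ‖θ k h‖ ≤ √d ∧ ∀ x, M.loss k h x = ⟪φ x, θ k h⟫)

/-- The joint law, under policy `π`, of the first `n` state-action pairs and of the state that
follows them. -/
def trajLaw (M : AdversarialMDP S A H K) (π : Policy S A H) :
    (n : ℕ) → n ≤ H → Measure ((Fin n → S × A) × S)
  | 0, _ => M.init.map (fun s => (Fin.elim0, s))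
  | n + 1, hn =>
    (((M.trajLaw π n (Nat.le_of_succ_le hn)) ⊗ₘ
        ((π.kernel ⟨n, hn⟩).comap Prod.snd measurable_snd)) ⊗ₘ
        ((M.trans ⟨n, hn⟩).comap (fun y : ((Fin n → S × A) × S) × A => (y.1.2, y.2))
          (by fun_prop))).map
      (fun z : (((Fin n → S × A) × S) × A) × S =>
        (Fin.snoc (α := fun _ => S × A) z.1.1.1 (z.1.1.2, z.1.2), z.2))

/-- The value of `π` in episode `k`: its expected cumulative loss `𝔼 [∑ h, ℓ_{k,h} (s_h, a_h)]`. -/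
def value (M : AdversarialMDP S A H K) (k : Fin K) (π : Policy S A H) : ℝ :=
  ∫ τ, ∑ h, M.loss k h (τ.1 h) ∂(M.trajLaw π H le_rfl)

/-- The regret of the policies `learner k`, `k = 1, …, K`, against the fixed policy `πstar`
(the cumulative regret, if `πstar` minimizes the total value over the `K` episodes). -/
def regret (M : AdversarialMDP S A H K) (learner : Fin K → Policy S A H)
    (πstar : Policy S A H) : ℝ :=
  ∑ k, (M.value k (learner k) - M.value k πstar)

/-- The least total value over the `K` episodes of a policy of the finite set `Pi`. -/
def bestIn (M : AdversarialMDP S A H K) (Pi : Finset (Policy S A H)) (hPi : Pi.Nonempty) : ℝ :=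
  Pi.inf' hPi (fun π => ∑ k, M.value k π)

/-- The regret of the policies `learner k` against the best policy of the finite set `Pi`. -/
def regretIn (M : AdversarialMDP S A H K) (learner : Fin K → Policy S A H)
    (Pi : Finset (Policy S A H)) (hPi : Pi.Nonempty) : ℝ :=
  (∑ k, M.value k (learner k)) - M.bestIn Pi hPi

end AdversarialMDP

end

/-!
Since the transitions are shared by all episodes, the total value `∑ k, V_k^π` is the value of `π`
in the single MDP whose loss is `∑ k, ℓ_{k,h}`. Let `V_n` be its optimal value function (`optValue`)
and `Q_n` the corresponding action value (`actionValue`). Linearity makes `Q_n = ⟪φ, w⟫` for some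
vector `w`, and `|Q_n| ≤ H K √d`. Along any policy, the expectation of "loss so far plus `V_n` at
the current state" (`potential`) is nondecreasing in `n`, and along a policy that is `ε`-greedy for
`Q_n` it increases by at most `ε` per step; as it starts from the same value for all policies, an
`ε`-greedy policy is within `H ε` of every other policy. It is therefore enough that `Π` contains,
for every linear MDP, a policy that is `1 / H`-greedy for the functions `Q_n`.

The normalization `‖μ_h(S)‖ ≤ √d` does not control the Euclidean norm of `w`: the total variation of
`μ_h` may be large if the features are almost degenerate. What is controlled is the seminorm `sup_x
|⟪φ x, w⟫| ≤ H K √d`. As `Π` may depend on `φ`, the net of parameters is taken in this seminorm,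
that is, in the space of functions `x ↦ ⟪φ x, w⟫` with the sup norm, which has dimension at most
`d`. The volume bound in finite-dimensional normed spaces gives a net `N` of the required size, with
precision `1 / (4 (H + 1))` (`exists_parameterNet`).

For every `v ∈ N`, separability of the features gives a measurable choice of an action that almost
maximizes `⟪φ (s, ·), v⟫`; the finitely many actions chosen in `s` form the set `act s`, of size at
most `|N|`; if `A` is finite, `act s = A` (`exists_actionSets`). On such a set the softmax policy
loses at most `|act s| / η` against the maximum (`le_sum_softmaxWeight_mul`), and nothing bounds `η`
from above. So the softmax policy whose parameter at step `h` is the net point closest to `-w`,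
where `Q_h = ⟪φ, w⟫`, is greedy up to four errors of size `1 / (4 (H + 1))`
(`integral_actionValue_le_optValue_add`).
-/

/-! ### Nets of linear functionals by volume comparison -/

/-- Volume bound for packings: the balls of radius `ε / 2` around the points of an `ε`-separated set
in the ball of radius `R` are disjoint and lie in the ball of radius `R + ε / 2`. -/
theorem card_le_of_separated_of_norm_le {E : Type*} [NormedAddCommGroup E] [NormedSpace ℝ E]
    [FiniteDimensional ℝ E] {R ε : ℝ} (hR : 0 ≤ R) (hε : 0 < ε) (s : Finset E)
    (hs : ∀ c ∈ s, ‖c‖ ≤ R) (h : ∀ c ∈ s, ∀ e ∈ s, c ≠ e → ε ≤ ‖c - e‖) :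
    (s.card : ℝ) ≤ (1 + 2 * R / ε) ^ Module.finrank ℝ E := by
  borelize E
  let μ : Measure E := Measure.addHaar
  have hδ : 0 < ε / 2 := by positivity
  have hρ : 0 < R + ε / 2 := by positivity
  have hdisj : (s : Set E).Pairwise
      (Function.onFun Disjoint fun c => Metric.ball (c : E) (ε / 2)) := by
    intro c hc e he hce
    apply Metric.ball_disjoint_ball
    rw [dist_eq_norm]
    linarith [h c hc e he hce]
  have hsub : ⋃ c ∈ s, Metric.ball (c : E) (ε / 2) ⊆ Metric.ball 0 (R + ε / 2) := by
    refine Set.iUnion₂_subset fun x hx => Metric.ball_subset_ball' ?_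
    rw [dist_zero_right]
    linarith [hs x hx]
  have hvol : (s.card : ENNReal) * ENNReal.ofReal ((ε / 2) ^ Module.finrank ℝ E) *
      μ (Metric.ball 0 1) ≤
        ENNReal.ofReal ((R + ε / 2) ^ Module.finrank ℝ E) * μ (Metric.ball 0 1) := by
    calc
      _ = μ (⋃ c ∈ s, Metric.ball (c : E) (ε / 2)) := by
        rw [measure_biUnion_finset hdisj fun c _ => measurableSet_ball]
        simp only [μ.addHaar_ball_of_pos _ hδ, Finset.sum_const, nsmul_eq_mul, mul_assoc]
      _ ≤ μ (Metric.ball 0 (R + ε / 2)) := measure_mono hsub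
      _ = _ := by simp only [μ.addHaar_ball_of_pos _ hρ]
  have hcard := ENNReal.toReal_le_of_le_ofReal (pow_nonneg hρ.le _)
    ((ENNReal.mul_le_mul_iff_left (Metric.measure_ball_pos μ _ zero_lt_one).ne'
      measure_ball_lt_top.ne).1 hvol)
  rw [ENNReal.toReal_mul, ENNReal.toReal_natCast, ENNReal.toReal_ofReal (by positivity)] at hcard
  rw [show 1 + 2 * R / ε = (R + ε / 2) / (ε / 2) by field_simp; ring, div_pow,
    le_div_iff₀ (by positivity)]
  exact hcard

/-- An `ε`-separated subset of the ball of radius `R` of maximal cardinality is an `ε`-net of it. -/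
theorem exists_finset_cover_closedBall {E : Type*} [NormedAddCommGroup E] [NormedSpace ℝ E]
    [FiniteDimensional ℝ E] {R ε : ℝ} (hR : 0 ≤ R) (hε : 0 < ε) :
    ∃ s : Finset E, (s.card : ℝ) ≤ (1 + 2 * R / ε) ^ Module.finrank ℝ E ∧
      ∀ x : E, ‖x‖ ≤ R → ∃ c ∈ s, ‖x - c‖ ≤ ε := by
  classical
  let T : Set ℕ := {n | ∃ s : Finset E, s.card = n ∧ (∀ c ∈ s, ‖c‖ ≤ R) ∧
    ∀ c ∈ s, ∀ e ∈ s, c ≠ e → ε ≤ ‖c - e‖}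
  have hT : BddAbove T := by
    refine ⟨⌊(1 + 2 * R / ε) ^ Module.finrank ℝ E⌋₊, ?_⟩
    rintro _ ⟨s, rfl, h1, h2⟩
    exact Nat.le_floor (card_le_of_separated_of_norm_le hR hε s h1 h2)
  have hne : T.Nonempty := ⟨0, ∅, by simp⟩
  obtain ⟨s, hcard, h1, h2⟩ := Nat.sSup_mem hne hT
  refine ⟨s, card_le_of_separated_of_norm_le hR hε s h1 h2, fun x hx => ?_⟩
  -- a point far from all of `s` could be added to the separated set `s` of maximal cardinality
  by_contra! hfar
  have hxs : x ∉ s := fun hmem => by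
    have := hfar x hmem
    rw [sub_self, norm_zero] at this
    exact absurd this hε.not_gt
  have hmem : s.card + 1 ∈ T := by
    refine ⟨insert x s, Finset.card_insert_of_notMem hxs, ?_, ?_⟩
    · simpa [hx] using h1
    · intro c hc e he hce
      rcases Finset.mem_insert.1 hc with hcx | hcs <;> rcases Finset.mem_insert.1 he with hex | hes
      · exact absurd (hcx.trans hex.symm) hce
      · rw [hcx]; exact (hfar e hes).le
      · rw [hex, norm_sub_rev]; exact (hfar c hcs).le
      · exact h2 c hcs e hes hce
  have := le_csSup hT hmem
  omega

/-- A net of the parameters `w` with `|⟪φ x, w⟫| ≤ R` for all `x`, for the seminorm `w ↦ sup_x |⟪φ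
x, w⟫|`. Its size does not depend on `φ`, however degenerate the features are. -/
theorem exists_finset_cover_inner {X : Type*} {d : ℕ} (φ : X → EuclideanSpace ℝ (Fin d))
    (hφ : ∀ x, ‖φ x‖ ≤ 1) {R ε : ℝ} (hR : 0 ≤ R) (hε : 0 < ε) :
    ∃ N : Finset (EuclideanSpace ℝ (Fin d)), (N.card : ℝ) ≤ (1 + 2 * R / ε) ^ d ∧
      ∀ w : EuclideanSpace ℝ (Fin d), (∀ x, |⟪φ x, w⟫| ≤ R) →
        ∃ v ∈ N, ∀ x, |⟪φ x, w⟫ - ⟪φ x, v⟫| ≤ ε := by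
  classical
  -- with the discrete topology, bounded continuous functions are bounded functions with the sup
  -- norm
  let _ : TopologicalSpace X := ⊥
  have _ : DiscreteTopology X := ⟨rfl⟩
  let T : EuclideanSpace ℝ (Fin d) →ₗ[ℝ] BoundedContinuousFunction X ℝ :=
    { toFun := fun w => BoundedContinuousFunction.ofNormedAddCommGroupDiscrete
        (fun x => ⟪φ x, w⟫) ‖w‖ fun x =>
          (norm_inner_le_norm _ _).trans (mul_le_of_le_one_left (norm_nonneg _) (hφ x))
      map_add' := fun v w => by ext x; exact inner_add_right (φ x) v w
      map_smul' := fun c w => by ext x; exact real_inner_smul_right (φ x) w c }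
  obtain ⟨s, hcard, hs⟩ := exists_finset_cover_closedBall (E := LinearMap.range T) hR hε
  have hlift : ∀ f : LinearMap.range T, ∃ w, T w = f := fun f => f.2
  choose g hg using hlift
  refine ⟨s.image g, ?_, fun w hw => ?_⟩
  · have hdim : Module.finrank ℝ (LinearMap.range T) ≤ d := by
      simpa using LinearMap.finrank_range_le T
    calc ((s.image g).card : ℝ) ≤ s.card := by exact_mod_cast Finset.card_image_le
      _ ≤ _ := hcard
      _ ≤ _ := pow_le_pow_right₀ (le_add_of_nonneg_right (by positivity)) hdim
  · have hTw : ‖T w‖ ≤ R := (BoundedContinuousFunction.norm_le hR).2 fun x => hw x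
    obtain ⟨c, hc, hdist⟩ := hs ⟨T w, w, rfl⟩ hTw
    refine ⟨g c, Finset.mem_image_of_mem g hc, fun x => ?_⟩
    have hnorm : ‖T w - T (g c)‖ ≤ ε := by rw [hg]; exact hdist
    exact ((T w - T (g c)).norm_coe_le_norm x).trans hnorm

/-! ### Finite action sets and softmax policies -/

theorem inner_le_of_mem_closure_image {X : Type*} {d : ℕ} {f : X → EuclideanSpace ℝ (Fin d)}
    {B : Set X} {u v : EuclideanSpace ℝ (Fin d)} {c : ℝ} (hu : u ∈ closure (f '' B))
    (h : ∀ b ∈ B, ⟪f b, v⟫ ≤ c) : ⟪u, v⟫ ≤ c := by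
  have hclosed : IsClosed {u : EuclideanSpace ℝ (Fin d) | ⟪u, v⟫ ≤ c} :=
    isClosed_le (by fun_prop) continuous_const
  exact closure_minimal (by rintro _ ⟨b, hb, rfl⟩; exact h b hb) hclosed hu

/-- In every state, the actions of one sequence suffice to bound a linear functional of the
features. -/
theorem exists_seq_inner_le {S A : Type*} [Nonempty A] {d : ℕ}
    {φ : S × A → EuclideanSpace ℝ (Fin d)} (hsep : SeparableFeatures φ) :
    ∃ e : ℕ → A, ∀ (s : S) (v : EuclideanSpace ℝ (Fin d)) (c : ℝ),
      (∀ j, ⟪φ (s, e j), v⟫ ≤ c) → ∀ a, ⟪φ (s, a), v⟫ ≤ c := by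
  obtain ⟨A₀, hA₀, hdense⟩ := hsep
  obtain ⟨a₀⟩ := ‹Nonempty A›
  obtain ⟨e, he⟩ := (hA₀.insert a₀).exists_eq_range (Set.insert_nonempty _ _)
  refine ⟨e, fun s v c h a => inner_le_of_mem_closure_image (hdense s a) fun b hb => ?_⟩
  obtain ⟨j, rfl⟩ : b ∈ Set.range e := he ▸ Set.mem_insert_of_mem _ hb
  exact h j

/-- Finite action sets of bounded size that contain, for every `v ∈ N` and every state, a maximizer
of `⟪φ (s, ·), v⟫` up to `δ`. They are all of `A` if `A` is finite. They depend on the state through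
a measurable map `g` into the countable type `N → ℕ`, which is what makes policies on them
measurable. -/
theorem exists_actionSets {S A : Type*} [MeasurableSpace S] [MeasurableSpace A] [Nonempty A]
    {d : ℕ} {φ : S × A → EuclideanSpace ℝ (Fin d)} (hφ : Measurable φ)
    (hsep : SeparableFeatures φ) {N : Finset (EuclideanSpace ℝ (Fin d))} (hN : N.Nonempty)
    (hbdd : ∀ v ∈ N, ∃ C, ∀ x, ⟪φ x, v⟫ ≤ C) {δ : ℝ} (hδ : 0 < δ) :
    ∃ (c : (N → ℕ) → Finset A) (g : S → N → ℕ) (n : ℕ), Measurable g ∧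
      (∀ i, (c i).Nonempty) ∧ (∀ i, (c i).card ≤ n) ∧ (Finite A → ∀ i a, a ∈ c i) ∧
      ∀ v ∈ N, ∀ s a, ∃ b ∈ c (g s), ⟪φ (s, a), v⟫ ≤ ⟪φ (s, b), v⟫ + δ := by
  classical
  by_cases hA : Finite A
  · have := Fintype.ofFinite A
    exact ⟨fun _ => Finset.univ, fun _ _ => 0, (Finset.univ : Finset A).card, measurable_const,
      fun _ => Finset.univ_nonempty, fun _ => le_rfl, fun _ _ a => Finset.mem_univ a,
      fun v _ s a => ⟨a, Finset.mem_univ a, by linarith⟩⟩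
  obtain ⟨e, he⟩ := exists_seq_inner_le hsep
  -- comparing with the actions of the sequence only keeps the condition measurable in `s`
  let p : N → S → ℕ → Prop := fun v s k => ∀ j, ⟪φ (s, e j), (v : EuclideanSpace ℝ (Fin d))⟫ ≤
    ⟪φ (s, e k), (v : EuclideanSpace ℝ (Fin d))⟫ + δ
  have hp : ∀ v s, ∃ k, p v s k := by
    intro v s
    obtain ⟨C, hC⟩ := hbdd v v.2
    have hb : BddAbove (Set.range fun j => ⟪φ (s, e j), (v : EuclideanSpace ℝ (Fin d))⟫) :=
      ⟨C, by rintro _ ⟨j, rfl⟩; exact hC _⟩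
    obtain ⟨k, hk⟩ := exists_lt_of_lt_ciSup (sub_lt_self
      (⨆ j, ⟪φ (s, e j), (v : EuclideanSpace ℝ (Fin d))⟫) hδ)
    exact ⟨k, fun j => by linarith [le_ciSup hb j]⟩
  have hmeas : ∀ v k, MeasurableSet {s | p v s k} := by
    intro v k
    have hm : ∀ j, Measurable fun s => ⟪φ (s, e j), (v : EuclideanSpace ℝ (Fin d))⟫ := fun j =>
      (hφ.comp (measurable_id.prodMk measurable_const)).inner_const
    simp only [p, Set.ofPred_forall]
    exact MeasurableSet.iInter fun j => measurableSet_le (hm j) ((hm k).add_const δ)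
  refine ⟨fun i => N.attach.image fun v => e (i v), fun s v => Nat.find (hp v s), N.card, ?_, ?_,
    ?_, fun h => absurd h hA, ?_⟩
  · exact measurable_pi_lambda _ fun v => measurable_find (hp v) (hmeas v)
  · exact fun i => hN.attach.image _
  · exact fun i => Finset.card_image_le.trans N.card_attach.le
  · intro v hv s a
    exact ⟨_, Finset.mem_image_of_mem _ (Finset.mem_attach N ⟨v, hv⟩),
      he s v _ (Nat.find_spec (hp ⟨v, hv⟩ s)) a⟩

theorem measurable_sum_actionSets {S A ι β : Type*} [MeasurableSpace S] [Countable ι]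
    [MeasurableSpace ι] [MeasurableSingletonClass ι] [AddCommMonoid β] [MeasurableSpace β]
    [MeasurableAdd₂ β] (c : ι → Finset A) {g : S → ι} (hg : Measurable g) {f : S → A → β}
    (hf : ∀ a, Measurable fun s => f s a) : Measurable fun s => ∑ a ∈ c (g s), f s a := by
  have h : Measurable fun q : ι × S => ∑ a ∈ c q.1, f q.2 a :=
    measurable_from_prod_countable_right fun i =>
      Finset.measurable_fun_sum (c i) fun a _ => hf a
  exact h.comp (hg.prodMk measurable_id)

/-- The probability of the action `a ∈ B` under the softmax distribution on the finite set `B` with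
inverse temperature `η` and scores `q`. -/
noncomputable def softmaxWeight {A : Type*} (η : ℝ) (q : A → ℝ) (B : Finset A) (a : A) : ℝ :=
  Real.exp (η * q a) / ∑ b ∈ B, Real.exp (η * q b)

theorem softmaxWeight_nonneg {A : Type*} (η : ℝ) (q : A → ℝ) (B : Finset A) (a : A) :
    0 ≤ softmaxWeight η q B a :=
  div_nonneg (Real.exp_nonneg _) (Finset.sum_nonneg fun _ _ => Real.exp_nonneg _)

theorem sum_softmaxWeight {A : Type*} (η : ℝ) (q : A → ℝ) {B : Finset A} (hB : B.Nonempty) :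
    ∑ a ∈ B, softmaxWeight η q B a = 1 := by
  simp only [softmaxWeight]
  rw [← Finset.sum_div]
  exact div_self (Finset.sum_pos (fun _ _ => Real.exp_pos _) hB).ne'

/-- The softmax mean of the scores is at least their maximum minus `B.card / η`. Each action
contributes at most `x * exp (-η x) ≤ 1 / η` to the gap, where `x` is the amount by which its score
falls short of the maximum. The entropy bound would have `log B.card` for `B.card`, but `η` is free.
-/
theorem le_sum_softmaxWeight_mul {A : Type*} {η : ℝ} (hη : 0 < η) (q : A → ℝ) {B : Finset A}
    {b : A} (hb : b ∈ B) :
    q b - B.card / η ≤ ∑ a ∈ B, softmaxWeight η q B a * q a := by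
  have hsum := sum_softmaxWeight η q ⟨b, hb⟩
  have hterm : ∀ a ∈ B, softmaxWeight η q B a * (q b - q a) ≤ 1 / η := by
    intro a _
    have hw : softmaxWeight η q B a ≤ Real.exp (-(η * (q b - q a))) := by
      rw [softmaxWeight, div_le_iff₀ (Finset.sum_pos (fun _ _ => Real.exp_pos _) ⟨b, hb⟩)]
      calc Real.exp (η * q a) = Real.exp (-(η * (q b - q a))) * Real.exp (η * q b) := by
            rw [← Real.exp_add]; congr 1; ring
        _ ≤ _ := mul_le_mul_of_nonneg_left (Finset.single_le_sum
            (f := fun b => Real.exp (η * q b)) (fun _ _ => Real.exp_nonneg _) hb)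
            (Real.exp_nonneg _)
    rcases le_or_gt (q b - q a) 0 with h | h
    · exact (mul_nonpos_of_nonneg_of_nonpos (softmaxWeight_nonneg η q B a) h).trans (by positivity)
    · rw [le_div_iff₀ hη]
      have hx : η * (q b - q a) ≤ Real.exp (η * (q b - q a)) := by
        linarith [Real.add_one_le_exp (η * (q b - q a))]
      calc softmaxWeight η q B a * (q b - q a) * η
          ≤ Real.exp (-(η * (q b - q a))) * (q b - q a) * η := by gcongr
        _ = Real.exp (-(η * (q b - q a))) * (η * (q b - q a)) := by ring
        _ ≤ Real.exp (-(η * (q b - q a))) * Real.exp (η * (q b - q a)) := by gcongr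
        _ = 1 := by rw [← Real.exp_add]; simp
  have htot : ∑ a ∈ B, softmaxWeight η q B a * (q b - q a) ≤ B.card / η := by
    calc _ ≤ ∑ a ∈ B, 1 / η := Finset.sum_le_sum hterm
      _ = _ := by simp [div_eq_mul_inv]
  simp only [mul_sub, Finset.sum_sub_distrib, ← Finset.sum_mul, hsum] at htot
  linarith

theorem exists_softmaxPolicy {S A ι : Type*} [MeasurableSpace S] [MeasurableSpace A] [Countable ι]
    [MeasurableSpace ι] [MeasurableSingletonClass ι] {H d : ℕ}
    {φ : S × A → EuclideanSpace ℝ (Fin d)} (hφ : Measurable φ) (c : ι → Finset A)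
    (hc : ∀ i, (c i).Nonempty) {g : S → ι} (hg : Measurable g) (η : ℝ)
    (w : Fin H → EuclideanSpace ℝ (Fin d)) :
    ∃ π : Policy S A H, ∀ h s, π.kernel h s = ∑ a ∈ c (g s),
      ENNReal.ofReal (softmaxWeight η (fun a => ⟪φ (s, a), w h⟫) (c (g s)) a) •
        Measure.dirac a := by
  have hm : ∀ h a, Measurable fun s => Real.exp (η * ⟪φ (s, a), w h⟫) := fun h a =>
    ((hφ.comp (measurable_id.prodMk measurable_const)).inner_const.const_mul η).exp
  refine ⟨⟨fun h => ⟨fun s => ∑ a ∈ c (g s),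
      ENNReal.ofReal (softmaxWeight η (fun a => ⟪φ (s, a), w h⟫) (c (g s)) a) •
        Measure.dirac a, ?_⟩, fun h => ⟨fun s => ⟨?_⟩⟩⟩, fun h s => rfl⟩
  · refine Measure.measurable_of_measurable_coe _ fun B _ => ?_
    simp only [Measure.coe_finsetSum, Finset.sum_apply, Measure.smul_apply, smul_eq_mul]
    exact measurable_sum_actionSets c hg fun a => (((hm h a).div
      (measurable_sum_actionSets c hg (hm h))).ennreal_ofReal).mul_const _
  · simp only [Kernel.coe_mk, Measure.coe_finsetSum, Finset.sum_apply, Measure.smul_apply,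
      measure_univ, smul_eq_mul, mul_one]
    rw [← ENNReal.ofReal_sum_of_nonneg fun a _ => softmaxWeight_nonneg _ _ _ _,
      sum_softmaxWeight _ _ (hc _), ENNReal.ofReal_one]

theorem integral_sum_softmaxWeight_dirac {A : Type*} [MeasurableSpace A] (η : ℝ) (q : A → ℝ)
    (B : Finset A) {f : A → ℝ} (hf : Measurable f) :
    ∫ a, f a ∂(∑ a ∈ B, ENNReal.ofReal (softmaxWeight η q B a) • Measure.dirac a) =
      ∑ a ∈ B, softmaxWeight η q B a * f a := by
  rw [integral_finsetSum_measure]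
  · refine Finset.sum_congr rfl fun a _ => ?_
    rw [integral_smul_measure, integral_dirac' _ _ hf.stronglyMeasurable,
      ENNReal.toReal_ofReal (softmaxWeight_nonneg _ _ _ _), smul_eq_mul]
  · intro a _
    exact (integrable_dirac' hf.stronglyMeasurable (by simp)).smul_measure ENNReal.ofReal_ne_top

/-! ### Dynamic programming in linear MDPs -/

namespace AdversarialMDP

variable {S A : Type*} [MeasurableSpace S] [MeasurableSpace A] {H K : ℕ}

/-- The loss at step `h`, summed over the episodes, plus the mean of the continuation value `V` at
the next state. -/
noncomputable def actionValue (M : AdversarialMDP S A H K) (V : S → ℝ) (h : Fin H) (x : S × A) :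
    ℝ :=
  ∑ k, M.loss k h x + ∫ s, V s ∂(M.trans h x)

/-- The optimal total value over the `K` episodes from step `n` on, as a function of the state at
step `n`, defined by the Bellman recursion. Steps are numbered from `0`; the value is `0` from the
horizon `H` on. The infimum is the true one (not a junk value) when the losses are bounded and `A`
is nonempty. -/
noncomputable def optValue (M : AdversarialMDP S A H K) (n : ℕ) : S → ℝ :=
  if hn : n < H then
    fun s => ⨅ a, M.actionValue (optValue M (n + 1)) ⟨n, hn⟩ (s, a)
  else 0
termination_by H - n

theorem optValue_of_lt (M : AdversarialMDP S A H K) {n : ℕ} (hn : n < H) (s : S) :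
    M.optValue n s = ⨅ a, M.actionValue (M.optValue (n + 1)) ⟨n, hn⟩ (s, a) := by
  rw [optValue, dif_pos hn]

theorem optValue_horizon (M : AdversarialMDP S A H K) : M.optValue H = 0 := by
  rw [optValue, dif_neg (lt_irrefl H)]

theorem IsLinear.abs_loss_le {M : AdversarialMDP S A H K} {d : ℕ}
    {φ : S × A → EuclideanSpace ℝ (Fin d)} (hM : M.IsLinear φ) (k : Fin K) (h : Fin H)
    (x : S × A) : |M.loss k h x| ≤ √d := by
  obtain ⟨hφ, -, θ, hθ⟩ := hM
  rw [(hθ k h).2 x]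
  calc _ ≤ ‖φ x‖ * ‖θ k h‖ := abs_real_inner_le_norm _ _
    _ ≤ 1 * √d := mul_le_mul (hφ x) (hθ k h).1 (norm_nonneg _) zero_le_one
    _ = _ := one_mul _

theorem IsLinear.measurable_loss {M : AdversarialMDP S A H K} {d : ℕ}
    {φ : S × A → EuclideanSpace ℝ (Fin d)} (hM : M.IsLinear φ) (hφ : Measurable φ) (k : Fin K)
    (h : Fin H) : Measurable (M.loss k h) := by
  obtain ⟨-, -, θ, hθ⟩ := hM
  rw [funext (hθ k h).2]
  exact hφ.inner_const

theorem IsLinear.abs_sum_loss_le {M : AdversarialMDP S A H K} {d : ℕ}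
    {φ : S × A → EuclideanSpace ℝ (Fin d)} (hM : M.IsLinear φ) (h : Fin H)
    (x : S × A) : |∑ k, M.loss k h x| ≤ K * √d := by
  calc _ ≤ ∑ k, |M.loss k h x| := Finset.abs_sum_le_sum_abs _ _
    _ ≤ ∑ _k : Fin K, √d := Finset.sum_le_sum fun k _ => hM.abs_loss_le k h x
    _ = _ := by simp

/-- The mean of `V` under the transition kernel is linear in the features. For a simple function
this is the assumption on the kernel; the general case follows by pointwise limits, since the
functions `x ↦ ⟪φ x, w⟫` form a finite-dimensional, hence closed, subspace of the product space `S ×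
A → ℝ`. No integral against the vector measure is needed. -/
theorem IsLinear.exists_inner_eq_integral {M : AdversarialMDP S A H K} {d : ℕ}
    {φ : S × A → EuclideanSpace ℝ (Fin d)} (hM : M.IsLinear φ) {V : S → ℝ} (hV : Measurable V)
    {C : ℝ} (hC : ∀ s, |V s| ≤ C) (h : Fin H) :
    ∃ w : EuclideanSpace ℝ (Fin d), ∀ x, ∫ s, V s ∂(M.trans h x) = ⟪φ x, w⟫ := by
  obtain ⟨-, ⟨μ, hμ⟩, -⟩ := hM
  have := M.trans_markov h
  let T : EuclideanSpace ℝ (Fin d) →ₗ[ℝ] (S × A → ℝ) :=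
    { toFun := fun w x => ⟪φ x, w⟫
      map_add' := fun v w => by ext x; exact inner_add_right (φ x) v w
      map_smul' := fun c w => by ext x; exact real_inner_smul_right (φ x) w c }
  have hclosed : IsClosed (LinearMap.range T : Set (S × A → ℝ)) :=
    Submodule.closed_of_finiteDimensional _
  have hsimple : ∀ f : SimpleFunc S ℝ, (fun x => ∫ s, f s ∂(M.trans h x)) ∈ LinearMap.range T := by
    intro f
    refine ⟨∑ y ∈ f.range, y • μ h (f ⁻¹' {y}), ?_⟩
    ext x
    rw [← SimpleFunc.integral_eq_integral f (SimpleFunc.integrable_of_isFiniteMeasure f),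
      SimpleFunc.integral_eq]
    simp only [T, LinearMap.coe_mk, AddHom.coe_mk, inner_sum, real_inner_smul_right, smul_eq_mul]
    refine Finset.sum_congr rfl fun y _ => ?_
    rw [← (hμ h).2 x _ (f.measurableSet_fiber y)]
    ring
  have hsm := hV.stronglyMeasurable
  have hlim : Filter.Tendsto (fun n x => ∫ s, hsm.approxBounded C n s ∂(M.trans h x)) Filter.atTop
      (nhds fun x => ∫ s, V s ∂(M.trans h x)) := by
    rw [tendsto_pi_nhds]
    intro x
    obtain ⟨s₀⟩ : Nonempty S := nonempty_of_isProbabilityMeasure (M.trans h x)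
    have hC0 : 0 ≤ C := (abs_nonneg _).trans (hC s₀)
    refine tendsto_integral_of_dominated_convergence (fun _ => C)
      (fun n => (SimpleFunc.measurable _).aestronglyMeasurable) (integrable_const C)
      (fun n => ae_of_all _ fun s => hsm.norm_approxBounded_le hC0 n s) (ae_of_all _ fun s => ?_)
    exact hsm.tendsto_approxBounded_of_norm_le (hC s)
  obtain ⟨w, hw⟩ := hclosed.mem_of_tendsto hlim (Filter.Eventually.of_forall fun n => hsimple _)
  exact ⟨w, fun x => (congrFun hw x).symm⟩

theorem IsLinear.exists_inner_eq_actionValue {M : AdversarialMDP S A H K} {d : ℕ}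
    {φ : S × A → EuclideanSpace ℝ (Fin d)} (hM : M.IsLinear φ) {V : S → ℝ} (hV : Measurable V)
    {C : ℝ} (hC : ∀ s, |V s| ≤ C) (h : Fin H) :
    ∃ w : EuclideanSpace ℝ (Fin d), ∀ x, M.actionValue V h x = ⟪φ x, w⟫ := by
  obtain ⟨w, hw⟩ := hM.exists_inner_eq_integral hV hC h
  obtain ⟨-, -, θ, hθ⟩ := hM
  refine ⟨∑ k, θ k h + w, fun x => ?_⟩
  rw [actionValue, hw, inner_add_right, inner_sum]
  exact congrArg (· + _) (Finset.sum_congr rfl fun k _ => (hθ k h).2 x)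

theorem IsLinear.abs_actionValue_le {M : AdversarialMDP S A H K} {d : ℕ}
    {φ : S × A → EuclideanSpace ℝ (Fin d)} (hM : M.IsLinear φ) {V : S → ℝ}
    {C : ℝ} (hC : ∀ s, |V s| ≤ C) (h : Fin H) (x : S × A) :
    |M.actionValue V h x| ≤ K * √d + C := by
  have := M.trans_markov h
  refine (abs_add_le _ _).trans (add_le_add (hM.abs_sum_loss_le h x) ?_)
  have := norm_integral_le_of_norm_le_const (μ := M.trans h x) (f := V)
    (ae_of_all _ hC)
  simpa using this

/-- Measurability and boundedness of the optimal value, proved together by backward induction: the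
recursion only makes sense for a bounded measurable continuation value, and the infimum over all
actions is measurable because a sequence of actions realizes it. -/
theorem IsLinear.measurable_abs_optValue_le [Nonempty A] {M : AdversarialMDP S A H K} {d : ℕ}
    {φ : S × A → EuclideanSpace ℝ (Fin d)} (hM : M.IsLinear φ) (hφ : Measurable φ)
    (hsep : SeparableFeatures φ) {n : ℕ} (hn : n ≤ H) :
    Measurable (M.optValue n) ∧ ∀ s, |M.optValue n s| ≤ (H - n : ℝ) * (K * √d) := by
  induction hn using Nat.decreasingInduction with
  | self => simp [optValue_horizon]; exact measurable_const
  | of_succ n hn ih =>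
    obtain ⟨w, hw⟩ := hM.exists_inner_eq_actionValue ih.1 ih.2 ⟨n, hn⟩
    obtain ⟨e, he⟩ := exists_seq_inner_le hsep
    have hbound := hM.abs_actionValue_le ih.2 ⟨n, hn⟩
    have hconst : K * √d + (H - (n + 1 : ℕ) : ℝ) * (K * √d) = (H - n : ℝ) * (K * √d) := by
      push_cast; ring
    rw [hconst] at hbound
    have hbdd : ∀ s, BddBelow (Set.range fun a =>
        M.actionValue (M.optValue (n + 1)) ⟨n, hn⟩ (s, a)) := fun s =>
      ⟨_, by rintro _ ⟨a, rfl⟩; exact (abs_le.1 (hbound _)).1⟩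
    have hbdd' : ∀ s, BddBelow (Set.range fun j => ⟪φ (s, e j), w⟫) := fun s =>
      (hbdd s).mono (by rintro _ ⟨j, rfl⟩; exact ⟨e j, hw _⟩)
    have hseq : M.optValue n = fun s => ⨅ j, ⟪φ (s, e j), w⟫ := by
      ext s
      rw [optValue_of_lt M hn]
      refine le_antisymm (le_ciInf fun j => ?_) (le_ciInf fun a => ?_)
      · exact (ciInf_le (hbdd s) (e j)).trans_eq (hw _)
      · rw [hw]
        have := he s (-w) (-⨅ j, ⟪φ (s, e j), w⟫) (fun j => by
          rw [inner_neg_right]; exact neg_le_neg (ciInf_le (hbdd' s) j)) a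
        rw [inner_neg_right] at this
        exact neg_le_neg_iff.1 this
    refine ⟨?_, fun s => ?_⟩
    · rw [hseq]
      exact Measurable.iInf fun j =>
        (hφ.comp (measurable_id.prodMk measurable_const)).inner_const
    · rw [optValue_of_lt M hn, abs_le]
      obtain ⟨a⟩ := ‹Nonempty A›
      exact ⟨@le_ciInf _ _ _ ⟨a⟩ _ _ fun a => (abs_le.1 (hbound _)).1,
        (ciInf_le (hbdd s) a).trans (abs_le.1 (hbound _)).2⟩

theorem IsLinear.optValue_le_actionValue [Nonempty A] {M : AdversarialMDP S A H K} {d : ℕ}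
    {φ : S × A → EuclideanSpace ℝ (Fin d)} (hM : M.IsLinear φ) (hφ : Measurable φ)
    (hsep : SeparableFeatures φ) {n : ℕ} (hn : n < H) (s : S) (a : A) :
    M.optValue n s ≤ M.actionValue (M.optValue (n + 1)) ⟨n, hn⟩ (s, a) := by
  rw [optValue_of_lt M hn]
  have hbound := hM.abs_actionValue_le (hM.measurable_abs_optValue_le hφ hsep hn).2 ⟨n, hn⟩
  exact ciInf_le ⟨_, by rintro _ ⟨a, rfl⟩; exact (abs_le.1 (hbound _)).1⟩ a

theorem IsLinear.optValue_le_integral_actionValue [Nonempty A] {M : AdversarialMDP S A H K} {d : ℕ}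
    {φ : S × A → EuclideanSpace ℝ (Fin d)} (hM : M.IsLinear φ) (hφ : Measurable φ)
    (hsep : SeparableFeatures φ) (π : Policy S A H) {n : ℕ} (hn : n < H) (s : S) :
    M.optValue n s ≤
      ∫ a, M.actionValue (M.optValue (n + 1)) ⟨n, hn⟩ (s, a) ∂(π.kernel ⟨n, hn⟩ s) := by
  have := π.markov ⟨n, hn⟩
  have hV := hM.measurable_abs_optValue_le hφ hsep hn
  obtain ⟨w, hw⟩ := hM.exists_inner_eq_actionValue hV.1 hV.2 ⟨n, hn⟩
  have hQi : Integrable (fun a => M.actionValue (M.optValue (n + 1)) ⟨n, hn⟩ (s, a))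
      (π.kernel ⟨n, hn⟩ s) := by
    refine Integrable.of_bound (Measurable.aestronglyMeasurable ?_) _
      (ae_of_all _ fun a => hM.abs_actionValue_le hV.2 ⟨n, hn⟩ _)
    simp only [hw]
    exact (hφ.comp measurable_prodMk_left).inner_const
  calc M.optValue n s = ∫ _a, M.optValue n s ∂(π.kernel ⟨n, hn⟩ s) := by simp
    _ ≤ _ := integral_mono (integrable_const _) hQi fun a =>
      hM.optValue_le_actionValue hφ hsep hn s a

theorem measurable_snoc_append {n : ℕ} :
    Measurable (fun z : (((Fin n → S × A) × S) × A) × S =>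
      ((Fin.snoc (α := fun _ => S × A) z.1.1.1 (z.1.1.2, z.1.2), z.2) :
        (Fin (n + 1) → S × A) × S)) := by
  refine Measurable.prodMk (measurable_pi_lambda _ fun i => ?_) measurable_snd
  refine Fin.lastCases ?_ (fun i => ?_) i
  · simp only [Fin.snoc_last]; fun_prop
  · simp only [Fin.snoc_castSucc]; fun_prop

instance isProbabilityMeasure_trajLaw (M : AdversarialMDP S A H K) (π : Policy S A H) :
    (n : ℕ) → (hn : n ≤ H) → IsProbabilityMeasure (M.trajLaw π n hn)
  | 0, _ => by
    have := M.init_prob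
    rw [trajLaw]
    exact Measure.isProbabilityMeasure_map (by fun_prop)
  | n + 1, hn => by
    have := isProbabilityMeasure_trajLaw M π n (Nat.le_of_succ_le hn)
    have := π.markov ⟨n, hn⟩
    have := M.trans_markov ⟨n, hn⟩
    rw [trajLaw]
    exact Measure.isProbabilityMeasure_map measurable_snoc_append.aemeasurable

/-- Fubini for one step of the trajectory. -/
theorem integral_trajLaw_succ (M : AdversarialMDP S A H K) (π : Policy S A H) {n : ℕ}
    (hn : n < H) {f : (Fin (n + 1) → S × A) × S → ℝ} (hf : Measurable f) {C : ℝ}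
    (hC : ∀ z, |f z| ≤ C) :
    ∫ z, f z ∂(M.trajLaw π (n + 1) hn) =
      ∫ z, ∫ a, ∫ s, f (Fin.snoc (α := fun _ => S × A) z.1 (z.2, a), s)
        ∂(M.trans ⟨n, hn⟩ (z.2, a)) ∂(π.kernel ⟨n, hn⟩ z.2) ∂(M.trajLaw π n hn.le) := by
  have := π.markov ⟨n, hn⟩
  have := M.trans_markov ⟨n, hn⟩
  rw [trajLaw, integral_map measurable_snoc_append.aemeasurable hf.aestronglyMeasurable]
  have hint := Integrable.of_bound (μ := ((M.trajLaw π n hn.le) ⊗ₘ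
        ((π.kernel ⟨n, hn⟩).comap Prod.snd measurable_snd)) ⊗ₘ
        ((M.trans ⟨n, hn⟩).comap (fun y : ((Fin n → S × A) × S) × A => (y.1.2, y.2))
          (by fun_prop))) (hf.comp measurable_snoc_append).aestronglyMeasurable C
    (ae_of_all _ fun z => hC _)
  refine (Measure.integral_compProd hint).trans ?_
  have hint' := Integrable.integral_compProd (κ := Kernel.const Unit _)
    (η := Kernel.prodMkLeft Unit _) (a := ()) hint
  exact Measure.integral_compProd hint'

/-- The total loss accumulated in the first `n` steps plus the optimal value of the remaining ones.
-/
noncomputable def potential (M : AdversarialMDP S A H K) (n : ℕ) (hn : n ≤ H)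
    (z : (Fin n → S × A) × S) : ℝ :=
  ∑ i, ∑ k, M.loss k (Fin.castLE hn i) (z.1 i) + M.optValue n z.2

theorem IsLinear.measurable_potential [Nonempty A] {M : AdversarialMDP S A H K} {d : ℕ}
    {φ : S × A → EuclideanSpace ℝ (Fin d)} (hM : M.IsLinear φ) (hφ : Measurable φ)
    (hsep : SeparableFeatures φ) {n : ℕ} (hn : n ≤ H) : Measurable (M.potential n hn) := by
  have hV := (hM.measurable_abs_optValue_le hφ hsep hn).1
  have hL := hM.measurable_loss hφ
  unfold potential
  fun_prop

theorem IsLinear.abs_potential_le [Nonempty A] {M : AdversarialMDP S A H K} {d : ℕ}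
    {φ : S × A → EuclideanSpace ℝ (Fin d)} (hM : M.IsLinear φ) (hφ : Measurable φ)
    (hsep : SeparableFeatures φ) {n : ℕ} (hn : n ≤ H) (z : (Fin n → S × A) × S) :
    |M.potential n hn z| ≤ H * (K * √d) := by
  calc |M.potential n hn z| ≤ ∑ _i : Fin n, K * √d + (H - n : ℝ) * (K * √d) :=
        (abs_add_le _ _).trans (add_le_add ((Finset.abs_sum_le_sum_abs _ _).trans
          (Finset.sum_le_sum fun i _ => hM.abs_sum_loss_le _ _))
          ((hM.measurable_abs_optValue_le hφ hsep hn).2 _))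
    _ = _ := by simp; ring

/-- One step of the performance difference: the mean potential increases by the mean of the amount
by which the action value under `π` exceeds the optimal value. -/
theorem IsLinear.integral_potential_succ [Nonempty A] {M : AdversarialMDP S A H K} {d : ℕ}
    {φ : S × A → EuclideanSpace ℝ (Fin d)} (hM : M.IsLinear φ) (hφ : Measurable φ)
    (hsep : SeparableFeatures φ) (π : Policy S A H) {n : ℕ} (hn : n < H) :
    ∫ z, M.potential (n + 1) hn z ∂(M.trajLaw π (n + 1) hn) -
        ∫ z, M.potential n hn.le z ∂(M.trajLaw π n hn.le) =
      ∫ z, (∫ a, M.actionValue (M.optValue (n + 1)) ⟨n, hn⟩ (z.2, a) ∂(π.kernel ⟨n, hn⟩ z.2) -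
        M.optValue n z.2) ∂(M.trajLaw π n hn.le) := by
  have := π.markov ⟨n, hn⟩
  have := M.trans_markov ⟨n, hn⟩
  have hV := hM.measurable_abs_optValue_le hφ hsep hn
  obtain ⟨w, hw⟩ := hM.exists_inner_eq_actionValue hV.1 hV.2 ⟨n, hn⟩
  have hQm : Measurable (M.actionValue (M.optValue (n + 1)) ⟨n, hn⟩) := by
    rw [funext hw]; exact hφ.inner_const
  have hQb := hM.abs_actionValue_le hV.2 ⟨n, hn⟩
  have hQi : ∀ s, Integrable (fun a => M.actionValue (M.optValue (n + 1)) ⟨n, hn⟩ (s, a))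
      (π.kernel ⟨n, hn⟩ s) := fun s =>
    Integrable.of_bound (hQm.comp measurable_prodMk_left).aestronglyMeasurable _
      (ae_of_all _ fun a => hQb _)
  have hpast : ∀ (z : (Fin n → S × A) × S), ∫ a, ∫ s,
      M.potential (n + 1) hn (Fin.snoc (α := fun _ => S × A) z.1 (z.2, a), s)
        ∂(M.trans ⟨n, hn⟩ (z.2, a)) ∂(π.kernel ⟨n, hn⟩ z.2) =
      M.potential n hn.le z + (∫ a, M.actionValue (M.optValue (n + 1)) ⟨n, hn⟩ (z.2, a)
        ∂(π.kernel ⟨n, hn⟩ z.2) - M.optValue n z.2) := by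
    intro z
    have hin : ∀ a, ∫ s, M.potential (n + 1) hn
        (Fin.snoc (α := fun _ => S × A) z.1 (z.2, a), s) ∂(M.trans ⟨n, hn⟩ (z.2, a)) =
        ∑ i, ∑ k, M.loss k (Fin.castLE hn.le i) (z.1 i) +
          M.actionValue (M.optValue (n + 1)) ⟨n, hn⟩ (z.2, a) := by
      intro a
      simp only [potential, Fin.sum_univ_castSucc, Fin.snoc_castSucc, Fin.snoc_last]
      rw [integral_add (integrable_const _), integral_const, probReal_univ, one_smul, actionValue]
      · exact add_assoc _ _ _
      · exact Integrable.of_bound hV.1.aestronglyMeasurable _ (ae_of_all _ hV.2)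
    simp only [hin]
    rw [integral_add (integrable_const _) (hQi z.2), integral_const, probReal_univ, one_smul,
      potential]
    ring
  have hmean : Measurable fun z : (Fin n → S × A) × S =>
      ∫ a, M.actionValue (M.optValue (n + 1)) ⟨n, hn⟩ (z.2, a) ∂(π.kernel ⟨n, hn⟩ z.2) :=
    (hQm.stronglyMeasurable.integral_kernel_prod_right'
      (κ := π.kernel ⟨n, hn⟩)).measurable.comp measurable_snd
  have hmeanb : ∀ s, ‖∫ a, M.actionValue (M.optValue (n + 1)) ⟨n, hn⟩ (s, a)
      ∂(π.kernel ⟨n, hn⟩ s)‖ ≤ _ := fun s => by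
    simpa using norm_integral_le_of_norm_le_const (μ := π.kernel ⟨n, hn⟩ s)
      (f := fun a => M.actionValue (M.optValue (n + 1)) ⟨n, hn⟩ (s, a)) (ae_of_all _ fun a => hQb (s, a))
  have hVn := hM.measurable_abs_optValue_le hφ hsep hn.le
  rw [M.integral_trajLaw_succ π hn (hM.measurable_potential hφ hsep hn)
    (hM.abs_potential_le hφ hsep hn), sub_eq_iff_eq_add', ← integral_add]
  · exact integral_congr_ae (ae_of_all _ hpast)
  · exact Integrable.of_bound (hM.measurable_potential hφ hsep hn.le).aestronglyMeasurable _
      (ae_of_all _ (hM.abs_potential_le hφ hsep hn.le))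
  · exact (Integrable.of_bound hmean.aestronglyMeasurable _ (ae_of_all _ fun z => hmeanb z.2)).sub
      (Integrable.of_bound (hVn.1.comp measurable_snd).aestronglyMeasurable _
        (ae_of_all _ fun z => hVn.2 z.2))

theorem IsLinear.sum_value_eq [Nonempty A] {M : AdversarialMDP S A H K} {d : ℕ}
    {φ : S × A → EuclideanSpace ℝ (Fin d)} (hM : M.IsLinear φ) (hφ : Measurable φ)
    (π : Policy S A H) :
    ∑ k, M.value k π = ∫ z, M.potential H le_rfl z ∂(M.trajLaw π H le_rfl) := by
  have hL := hM.measurable_loss hφ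
  simp only [value]
  rw [← integral_finsetSum]
  · refine integral_congr_ae (ae_of_all _ fun z => ?_)
    simp only [potential, optValue_horizon, Pi.zero_apply, add_zero]
    exact Finset.sum_comm
  · intro k _
    refine Integrable.of_bound (Measurable.aestronglyMeasurable (by fun_prop)) (∑ _h : Fin H, √d)
      (ae_of_all _ fun z => ?_)
    exact (Finset.abs_sum_le_sum_abs _ _).trans
      (Finset.sum_le_sum fun h _ => hM.abs_loss_le k h _)

theorem potential_zero_integral (M : AdversarialMDP S A H K) (π π' : Policy S A H) :
    ∫ z, M.potential 0 (Nat.zero_le H) z ∂(M.trajLaw π 0 (Nat.zero_le H)) =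
      ∫ z, M.potential 0 (Nat.zero_le H) z ∂(M.trajLaw π' 0 (Nat.zero_le H)) := by
  simp only [trajLaw]

/-- No policy does better than the initial mean of the optimal value. -/
theorem IsLinear.integral_potential_zero_le_sum_value [Nonempty A] {M : AdversarialMDP S A H K}
    {d : ℕ} {φ : S × A → EuclideanSpace ℝ (Fin d)} (hM : M.IsLinear φ) (hφ : Measurable φ)
    (hsep : SeparableFeatures φ) (π : Policy S A H) :
    ∫ z, M.potential 0 (Nat.zero_le H) z ∂(M.trajLaw π 0 (Nat.zero_le H)) ≤
      ∑ k, M.value k π := by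
  rw [hM.sum_value_eq hφ]
  suffices h : ∀ n (hn : n ≤ H),
      ∫ z, M.potential 0 (Nat.zero_le H) z ∂(M.trajLaw π 0 (Nat.zero_le H)) ≤
        ∫ z, M.potential n hn z ∂(M.trajLaw π n hn) from h H le_rfl
  intro n
  induction n with
  | zero => exact fun _ => le_rfl
  | succ n ih =>
    intro hn
    refine (ih (Nat.le_of_succ_le hn)).trans (sub_nonneg.1 ?_)
    rw [hM.integral_potential_succ hφ hsep π hn]
    exact integral_nonneg fun z => sub_nonneg.2
      (hM.optValue_le_integral_actionValue hφ hsep π hn z.2)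

/-- A policy that is `ε`-greedy for the optimal action values exceeds the initial mean of the
optimal value by at most `H * ε`. -/
theorem IsLinear.sum_value_le_of_greedy [Nonempty A] {M : AdversarialMDP S A H K}
    {d : ℕ} {φ : S × A → EuclideanSpace ℝ (Fin d)} (hM : M.IsLinear φ) (hφ : Measurable φ)
    (hsep : SeparableFeatures φ) (π : Policy S A H) {ε : ℝ}
    (hπ : ∀ n (hn : n < H) s, ∫ a, M.actionValue (M.optValue (n + 1)) ⟨n, hn⟩ (s, a)
      ∂(π.kernel ⟨n, hn⟩ s) ≤ M.optValue n s + ε) :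
    ∑ k, M.value k π ≤
      ∫ z, M.potential 0 (Nat.zero_le H) z ∂(M.trajLaw π 0 (Nat.zero_le H)) + H * ε := by
  rw [hM.sum_value_eq hφ]
  suffices h : ∀ n (hn : n ≤ H), ∫ z, M.potential n hn z ∂(M.trajLaw π n hn) ≤
      ∫ z, M.potential 0 (Nat.zero_le H) z ∂(M.trajLaw π 0 (Nat.zero_le H)) + n * ε from h H le_rfl
  intro n
  induction n with
  | zero => simp
  | succ n ih =>
    intro hn
    have hstep := hM.integral_potential_succ hφ hsep π hn
    have hle := integral_mono_of_nonneg (μ := M.trajLaw π n (Nat.le_of_succ_le hn))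
      (ae_of_all _ fun z => ?_) (integrable_const ε) (ae_of_all _ fun z =>
        sub_le_iff_le_add'.2 (hπ n hn z.2))
    · rw [← hstep, integral_const, probReal_univ, one_smul] at hle
      push_cast
      linarith [ih (Nat.le_of_succ_le hn)]
    · exact sub_nonneg.2 (hM.optValue_le_integral_actionValue hφ hsep π hn z.2)

end AdversarialMDP

/-! ### The finite class of softmax policies -/

/-- Softmax with a parameter `v` close to that of `-Q` is almost greedy for `Q`. The approximation
of `-Q` by `⟪φ, v⟫` is used twice (for the mean and for the competing action); the restriction to
`B` and the softmax gap cost `δ` each. -/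
theorem AdversarialMDP.IsLinear.integral_actionValue_le_optValue_add {S A : Type*}
    [MeasurableSpace S] [MeasurableSpace A] [Nonempty A] {H K d : ℕ}
    {M : AdversarialMDP S A H K} {φ : S × A → EuclideanSpace ℝ (Fin d)} (hM : M.IsLinear φ)
    (hφ : Measurable φ) (hsep : SeparableFeatures φ) {n : ℕ} (hn : n < H) (s : S)
    {v : EuclideanSpace ℝ (Fin d)} {B : Finset A} {η ε δ : ℝ} (hη : 0 < η) (hBne : B.Nonempty)
    (hv : ∀ x, |M.actionValue (M.optValue (n + 1)) ⟨n, hn⟩ x + ⟪φ x, v⟫| ≤ ε)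
    (hB : ∀ a, ∃ b ∈ B, ⟪φ (s, a), v⟫ ≤ ⟪φ (s, b), v⟫ + δ) (hcard : B.card / η ≤ δ) :
    ∫ a, M.actionValue (M.optValue (n + 1)) ⟨n, hn⟩ (s, a) ∂(∑ a ∈ B,
        ENNReal.ofReal (softmaxWeight η (fun a => ⟪φ (s, a), v⟫) B a) • Measure.dirac a) ≤
      M.optValue n s + (2 * ε + 2 * δ) := by
  have hV := hM.measurable_abs_optValue_le hφ hsep hn
  obtain ⟨w, hw⟩ := hM.exists_inner_eq_actionValue hV.1 hV.2 ⟨n, hn⟩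
  rw [integral_sum_softmaxWeight_dirac]
  swap
  · simp only [hw]
    exact (hφ.comp measurable_prodMk_left).inner_const
  have hsum := sum_softmaxWeight η (fun a => ⟪φ (s, a), v⟫) hBne
  rw [← sub_le_iff_le_add, AdversarialMDP.optValue_of_lt M hn]
  refine le_ciInf fun a => ?_
  obtain ⟨b, hb, hab⟩ := hB a
  have hgap := le_sum_softmaxWeight_mul hη (fun a => ⟪φ (s, a), v⟫) hb
  have hle : ∑ a ∈ B, softmaxWeight η (fun a => ⟪φ (s, a), v⟫) B a *
      M.actionValue (M.optValue (n + 1)) ⟨n, hn⟩ (s, a) ≤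
      ∑ a ∈ B, softmaxWeight η (fun a => ⟪φ (s, a), v⟫) B a * (ε - ⟪φ (s, a), v⟫) :=
    Finset.sum_le_sum fun a _ => mul_le_mul_of_nonneg_left
      (by linarith [(abs_le.1 (hv (s, a))).2]) (softmaxWeight_nonneg _ _ _ _)
  simp only [mul_sub, Finset.sum_sub_distrib, ← Finset.sum_mul, hsum] at hle
  linarith [(abs_le.1 (hv (s, a))).1]

/-- The size of the net of `H`-tuples of parameters against the claimed bound. If one of `d`, `H`,
`K` vanishes, both bases are `1`. -/
theorem covering_pow_le (d H K : ℕ) {m : ℝ} (hm : 0 ≤ m)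
    (h : m ≤ (1 + 2 * (H * (K * √d)) / (1 / (4 * (H + 1)))) ^ d) :
    m ^ H ≤ (1 + 32 * (K : ℝ) ^ 2 * (H : ℝ) ^ 4 * (d : ℝ) ^ (5 / 2 : ℝ) *
          Real.log (1 + 16 * H * d * K)) ^ (d * H ^ 2) := by
  have hbase : 2 * (H * (K * √d)) / (1 / (4 * ((H : ℝ) + 1))) ≤
      32 * (K : ℝ) ^ 2 * (H : ℝ) ^ 4 * (d : ℝ) ^ (5 / 2 : ℝ) *
          Real.log (1 + 16 * H * d * K) := by
    rcases Nat.eq_zero_or_pos d with rfl | hd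
    · simp
    rcases Nat.eq_zero_or_pos H with rfl | hH
    · simp
    rcases Nat.eq_zero_or_pos K with rfl | hK
    · simp
    have hd : (1 : ℝ) ≤ d := by exact_mod_cast hd
    have hH : (1 : ℝ) ≤ H := by exact_mod_cast hH
    have hK : (1 : ℝ) ≤ K := by exact_mod_cast hK
    have hlog : 1 ≤ Real.log (1 + 16 * H * d * K) := by
      rw [Real.le_log_iff_exp_le (by positivity)]
      have : (1 : ℝ) ≤ H * d * K :=
        one_le_mul_of_one_le_of_one_le (one_le_mul_of_one_le_of_one_le hH hd) hK
      nlinarith [Real.exp_one_lt_d9]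
    have hsqrt : √(d : ℝ) ≤ (d : ℝ) ^ (5 / 2 : ℝ) := by
      rw [Real.sqrt_eq_rpow]
      exact Real.rpow_le_rpow_of_exponent_le hd (by norm_num)
    have hK2 : (K : ℝ) ≤ K ^ 2 := le_self_pow₀ hK two_ne_zero
    have hH4 : (H : ℝ) * (H + 1) ≤ 2 * H ^ 4 := by
      nlinarith [pow_le_pow_right₀ hH (show 2 ≤ 4 by norm_num)]
    calc 2 * (H * (K * √d)) / (1 / (4 * ((H : ℝ) + 1)))
        = 8 * K * (H * (H + 1)) * √d := by field_simp; ring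
      _ ≤ 8 * K ^ 2 * (2 * H ^ 4) * (d : ℝ) ^ (5 / 2 : ℝ) := by gcongr
      _ ≤ 32 * K ^ 2 * H ^ 4 * (d : ℝ) ^ (5 / 2 : ℝ) * 1 := by
        have : 0 ≤ (K : ℝ) ^ 2 * H ^ 4 * (d : ℝ) ^ (5 / 2 : ℝ) := by positivity
        nlinarith
      _ ≤ _ := by gcongr
  have hnonneg : 0 ≤ 2 * (H * (K * √d)) / (1 / (4 * ((H : ℝ) + 1))) := by positivity
  calc m ^ H ≤ ((1 + 2 * (H * (K * √d)) / (1 / (4 * (H + 1)))) ^ d) ^ H := by gcongr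
    _ = (1 + 2 * (H * (K * √d)) / (1 / (4 * (H + 1)))) ^ (d * H) := (pow_mul _ _ _).symm
    _ ≤ (1 + 2 * (H * (K * √d)) / (1 / (4 * (H + 1)))) ^ (d * H ^ 2) :=
      pow_le_pow_right₀ (by linarith) (Nat.mul_le_mul_left d (Nat.le_self_pow two_ne_zero H))
    _ ≤ _ := by gcongr

/-- The net of parameters for the bound `H K √d` on the action values. Features of norm more than
`1` occur in no linear MDP, and then `N = {0}` will do. -/
theorem exists_parameterNet {S A : Type*} (d H K : ℕ) (φ : S × A → EuclideanSpace ℝ (Fin d)) :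
    ∃ N : Finset (EuclideanSpace ℝ (Fin d)), N.Nonempty ∧
      (∀ v ∈ N, ∃ C, ∀ x, ⟪φ x, v⟫ ≤ C) ∧
      (N.card : ℝ) ≤ (1 + 2 * (H * (K * √d)) / (1 / (4 * (H + 1)))) ^ d ∧
      ((∀ x, ‖φ x‖ ≤ 1) → ∀ w, (∀ x, |⟪φ x, w⟫| ≤ H * (K * √d)) →
        ∃ v ∈ N, ∀ x, |⟪φ x, w⟫ - ⟪φ x, v⟫| ≤ 1 / (4 * (H + 1))) := by
  by_cases hφ : ∀ x, ‖φ x‖ ≤ 1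
  · obtain ⟨N, hcard, hN⟩ := exists_finset_cover_inner φ hφ
      (R := H * (K * √d)) (ε := 1 / (4 * (H + 1))) (by positivity) (by positivity)
    obtain ⟨v, hv, -⟩ := hN 0 (fun x => by rw [inner_zero_right, abs_zero]; positivity)
    exact ⟨N, ⟨v, hv⟩, fun v _ => ⟨1 * ‖v‖, fun x => (real_inner_le_norm _ _).trans
      (mul_le_mul_of_nonneg_right (hφ x) (norm_nonneg v))⟩, hcard, fun _ => hN⟩
  · refine ⟨{0}, Finset.singleton_nonempty _, ?_, ?_, fun h => absurd h hφ⟩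
    · simp only [Finset.mem_singleton, forall_eq, inner_zero_right]
      exact ⟨0, fun _ => le_rfl⟩
    · rw [Finset.card_singleton, Nat.cast_one]
      exact one_le_pow₀ (le_add_of_nonneg_right (by positivity))

theorem lemma14 {S A : Type*} [MeasurableSpace S] [MeasurableSpace A] [Nonempty A]
    (d H K : ℕ) (φ : S × A → EuclideanSpace ℝ (Fin d)) (hφ : Measurable φ)
    (hsep : SeparableFeatures φ) :
    ∃ (η : ℝ) (act : S → Finset A) (Pi : Finset (Policy S A H)) (hPi : Pi.Nonempty),
      0 < η ∧ (∀ s, (act s).Nonempty) ∧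
      (Finite A → ∀ s a, a ∈ act s) ∧
      (∀ π ∈ Pi, IsLinearSoftmax φ η act π) ∧
      (Pi.card : ℝ) ≤
        (1 + 32 * (K : ℝ) ^ 2 * (H : ℝ) ^ 4 * (d : ℝ) ^ (5 / 2 : ℝ) *
          Real.log (1 + 16 * H * d * K)) ^ (d * H ^ 2) ∧
      ∀ M : AdversarialMDP S A H K, M.IsLinear φ →
        (∃ π ∈ Pi, ∀ πstar : Policy S A H,
          ∑ k, (M.value k π - M.value k πstar) ≤ 1) ∧
        ∀ (learner : Fin K → Policy S A H) (πstar : Policy S A H),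
          M.regret learner πstar =
              (M.bestIn Pi hPi - ∑ k, M.value k πstar) + M.regretIn learner Pi hPi ∧
            M.regret learner πstar ≤ M.regretIn learner Pi hPi + 1 := by
  classical
  obtain ⟨N, hNne, hNbdd, hNcard, hN⟩ := exists_parameterNet d H K φ
  have hε : (0 : ℝ) < 1 / (4 * (H + 1)) := by positivity
  obtain ⟨c, g, n, hg, hcne, hccard, hcfin, hcmax⟩ :=
    exists_actionSets hφ hsep hNne hNbdd hε
  set ε : ℝ := 1 / (4 * (H + 1)) with hεdef
  have hη : 0 < ((n : ℝ) + 1) / ε := by positivity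
  -- the choice that makes the softmax gap `n / η` at most `ε`
  set η : ℝ := ((n : ℝ) + 1) / ε with hηdef
  choose pol hpol using exists_softmaxPolicy (H := H) hφ c hcne hg η
  have hPi : ((Fintype.piFinset fun _ : Fin H => N).image pol).Nonempty :=
    (Fintype.piFinset_nonempty.2 fun _ => hNne).image _
  refine ⟨η, fun s => c (g s), (Fintype.piFinset fun _ : Fin H => N).image pol, hPi, hη,
    fun s => hcne _, fun h s a => hcfin h _ a, ?_, ?_, ?_⟩
  · intro π hπ
    obtain ⟨w, -, rfl⟩ := Finset.mem_image.1 hπ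
    exact ⟨w, hpol w⟩
  · have hcard : (((Fintype.piFinset fun _ : Fin H => N).image pol).card : ℝ) ≤
        (N.card : ℝ) ^ H := by
      have := Finset.card_image_le (s := Fintype.piFinset fun _ : Fin H => N) (f := pol)
      rw [Fintype.card_piFinset_const] at this
      exact_mod_cast this
    exact hcard.trans (covering_pow_le d H K (Nat.cast_nonneg _) hNcard)
  intro M hM
  have hgood : ∃ π ∈ (Fintype.piFinset fun _ : Fin H => N).image pol, ∀ πstar : Policy S A H,
      ∑ k, (M.value k π - M.value k πstar) ≤ 1 := by
    have hw : ∀ h : Fin H, ∃ v ∈ N, ∀ x,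
        |M.actionValue (M.optValue (h + 1)) h x + ⟪φ x, v⟫| ≤ ε := by
      intro h
      have hV := hM.measurable_abs_optValue_le hφ hsep (Nat.succ_le_of_lt h.2)
      obtain ⟨w, hw⟩ := hM.exists_inner_eq_actionValue hV.1 hV.2 h
      -- softmax prefers large scores and losses are minimized: the parameter approximates `-Q`
      obtain ⟨v, hv, hvw⟩ := hN hM.1 (-w) (fun x => by
        rw [inner_neg_right, abs_neg, ← hw]
        refine (hM.abs_actionValue_le hV.2 h x).trans ?_
        have : 0 ≤ (h : ℝ) * (K * √d) := by positivity
        push_cast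
        linarith)
      refine ⟨v, hv, fun x => ?_⟩
      have := hvw x
      rwa [inner_neg_right, ← hw, ← neg_add', abs_neg] at this
    choose v hv hvQ using hw
    refine ⟨pol v, Finset.mem_image_of_mem _ (Fintype.mem_piFinset.2 hv), fun πstar => ?_⟩
    have hup := hM.sum_value_le_of_greedy hφ hsep (pol v) (ε := 2 * ε + 2 * ε) fun m hm s => by
      rw [hpol]
      refine hM.integral_actionValue_le_optValue_add hφ hsep hm s hη (hcne _) (hvQ ⟨m, hm⟩)
        (hcmax _ (hv _) s) ?_
      rw [div_le_iff₀ hη, hηdef, mul_div_cancel₀ _ hε.ne']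
      exact (Nat.cast_le.2 (hccard _)).trans (by linarith)
    have hlow := hM.integral_potential_zero_le_sum_value hφ hsep πstar
    rw [M.potential_zero_integral πstar (pol v)] at hlow
    have herr : (H : ℝ) * (2 * ε + 2 * ε) ≤ 1 := by
      rw [hεdef, show (H : ℝ) * (2 * (1 / (4 * (H + 1))) + 2 * (1 / (4 * (H + 1)))) = H / (H + 1) by
        field_simp; ring]
      exact (div_le_one (by positivity)).2 (by linarith)
    rw [Finset.sum_sub_distrib]
    linarith
  refine ⟨hgood, fun learner πstar => ?_⟩
  have hdecomp : M.regret learner πstar = (M.bestIn _ hPi - ∑ k, M.value k πstar) +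
      M.regretIn learner _ hPi := by
    rw [AdversarialMDP.regret, AdversarialMDP.regretIn, Finset.sum_sub_distrib]
    ring
  refine ⟨hdecomp, ?_⟩
  obtain ⟨π, hπ, hbest⟩ := hgood
  have hle : M.bestIn _ hPi ≤ ∑ k, M.value k π := Finset.inf'_le _ hπ
  have := hbest πstar
  rw [Finset.sum_sub_distrib] at this
  linarith
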